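/- Let $\mathbb{N}=\{1,2,3,\dots\}$. For every finite colouring $c:\mathbb{N}\to\{1,\dots,r\}$ and every $k\in\mathbb{N}$ there are an infinite set $A\subseteq\mathbb{N}$ and a set $B\subseteq\mathbb{N}$ with exactly $k$ elements such that $(A+B)\cup(AB)$ is monochromatic, i.e. $c$ is constant on $(A+B)\cup(AB)$, where $A+B=\{a+b: a\in A,\ b\in B\}$ and $AB=\{ab: a\in A,\ b\in B\}$. -/

import Mathlib

open scoped Pointwise

/-- A set `S` of positive integers is monochromatic for the colouring `c` if all its elements
have one and the same colour. -/
def IsMonochromatic {r : ℕ} (c : ℕ+ → Fin r) (S : Set ℕ+) : Prop :=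
  ∃ i : Fin r, ∀ n ∈ S, c n = i

/-! Take a divisibility chain of `r * k + 1` numbers and a piecewise syndetic `U` with `u * p` and
`u * p + q / p` both coloured `t p`. By pigeonhole `k + 1` chain members share a value of `t`; if
`p` is the least, `A = p * U` and `B = {q / p}` work, since `(u * p) * (q / p) = u * q`. The chain
grows because `u * p + q / p = p * (u + q / p ^ 2)`: it suffices that `U` contains the shifts of `u`
by all `q / p ^ 2`, which van der Waerden supplies on a piecewise syndetic set of `u`. -/

/-- A finitary van der Waerden theorem: the monochromatic homothetic copy of `S` can be found in an
initial segment that does not depend on the colouring. -/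
theorem exists_bounded_mono_homothetic_copy (S : Finset ℕ) (κ : Type*) [Finite κ] :
    ∃ L : ℕ, ∀ C : ℕ → κ, ∃ y b : ℕ, ∃ i : κ, 0 < y ∧ y ≤ L ∧ b ≤ L ∧
      ∀ s ∈ S, y * s + b ≤ L ∧ C (y * s + b) = i := by
  classical
  obtain ⟨ι, _, hι⟩ := Combinatorics.Line.exists_mono_in_high_dimension S κ
  refine ⟨Fintype.card ι + Fintype.card ι * S.sup id, fun C => ?_⟩
  -- Hales–Jewett, colouring a word by its coordinate sum: along a line the sum is affine, with
  -- slope the number of active coordinates.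
  obtain ⟨l, i, hl⟩ := hι fun v => C (∑ j, (v j : ℕ))
  have hle : ∀ s ∈ S, s ≤ S.sup id := fun s hs => Finset.le_sup (f := id) hs
  set D : Finset ι := {j | l.idxFun j = none} with hD
  set b : ℕ := ∑ j ∈ Dᶜ, ((l.idxFun j).map (fun s : S => (s : ℕ))).getD 0 with hb
  have hsum : ∀ s (hs : s ∈ S), ∑ j, (l ⟨s, hs⟩ j : ℕ) = D.card * s + b := by
    intro s hs
    rw [← Finset.sum_add_sum_compl D, hb]
    congr 1
    · rw [← smul_eq_mul, ← Finset.sum_const]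
      refine Finset.sum_congr rfl fun j hj => ?_
      rw [hD, Finset.mem_filter] at hj
      rw [l.apply_none _ _ hj.2]
    · refine Finset.sum_congr rfl fun j hj => ?_
      rw [hD, Finset.mem_compl, Finset.mem_filter] at hj
      obtain ⟨z, hz⟩ := Option.ne_none_iff_exists.mp fun h => hj ⟨Finset.mem_univ _, h⟩
      simp [← hz]
  refine ⟨D.card, b, i, ?_, ?_, ?_, fun s hs => ⟨?_, ?_⟩⟩
  · obtain ⟨j, hj⟩ := l.proper
    exact Finset.card_pos.mpr ⟨j, by simp [hD, hj]⟩
  · exact (Finset.card_le_univ D).trans (Nat.le_add_right _ _)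
  · have : b ≤ Dᶜ.card • S.sup id := by
      refine Finset.sum_le_card_nsmul _ _ _ fun j _ => ?_
      cases l.idxFun j with
      | none => simp
      | some z => simpa using hle z z.2
    refine this.trans ?_
    rw [smul_eq_mul]
    exact (Nat.mul_le_mul_right _ (Finset.card_le_univ _)).trans (Nat.le_add_left _ _)
  · rw [← hsum s hs]
    have : ∑ j, (l ⟨s, hs⟩ j : ℕ) ≤ (Finset.univ : Finset ι).card • S.sup id :=
      Finset.sum_le_card_nsmul _ _ _ fun j _ => hle _ (l ⟨s, hs⟩ j).2
    rw [smul_eq_mul, Finset.card_univ] at this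
    omega
  · rw [← hsum s hs]
    exact hl ⟨s, hs⟩

/-- A set of natural numbers is piecewise syndetic if it has bounded gaps on arbitrarily long
intervals. -/
def IsPiecewiseSyndetic (S : Set ℕ) : Prop :=
  ∃ n, ∀ N, ∃ a, ∀ x, a ≤ x → x ≤ a + N → ∃ y ∈ S, x ≤ y ∧ y ≤ x + n

namespace IsPiecewiseSyndetic

theorem mono {S T : Set ℕ} (hS : IsPiecewiseSyndetic S) (h : S ⊆ T) : IsPiecewiseSyndetic T := by
  obtain ⟨n, hn⟩ := hS
  refine ⟨n, fun N => ?_⟩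
  obtain ⟨a, ha⟩ := hn N
  refine ⟨a, fun x h1 h2 => ?_⟩
  obtain ⟨y, hy, hxy⟩ := ha x h1 h2
  exact ⟨y, h hy, hxy⟩

theorem exists_ge {S : Set ℕ} (hS : IsPiecewiseSyndetic S) (N : ℕ) : ∃ y ∈ S, N ≤ y := by
  obtain ⟨n, hn⟩ := hS
  obtain ⟨a, ha⟩ := hn N
  obtain ⟨y, hy, h, -⟩ := ha (a + N) (by omega) le_rfl
  exact ⟨y, hy, by omega⟩

theorem infinite {S : Set ℕ} (hS : IsPiecewiseSyndetic S) : S.Infinite :=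
  Set.infinite_of_not_bddAbove fun ⟨M, hM⟩ => by
    obtain ⟨y, hy, h⟩ := hS.exists_ge (M + 1)
    have := hM hy
    omega

theorem setOf_pos : IsPiecewiseSyndetic {n : ℕ | 0 < n} :=
  ⟨1, fun _ => ⟨0, fun x _ _ => ⟨x + 1, Nat.succ_pos x, by omega, le_rfl⟩⟩⟩

/-- If `S` fails, it has long gaps in every long enough interval; where `S ∪ T` has short gaps, `T`
alone must fill such a gap. -/
theorem of_union {S T : Set ℕ} (h : IsPiecewiseSyndetic (S ∪ T)) :
    IsPiecewiseSyndetic S ∨ IsPiecewiseSyndetic T := by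
  refine or_iff_not_imp_left.mpr fun hS => ?_
  obtain ⟨n, hn⟩ := h
  refine ⟨n, fun N => ?_⟩
  simp only [IsPiecewiseSyndetic, not_exists, not_forall] at hS
  obtain ⟨K, hK⟩ := hS (N + n)
  obtain ⟨a, ha⟩ := hn (K + N)
  obtain ⟨x, hax, hxa, hx⟩ := hK a
  refine ⟨x, fun z h1 h2 => ?_⟩
  obtain ⟨y, hy, hzy, hyz⟩ := ha z (by omega) (by omega)
  rcases hy with hy | hy
  · exact absurd ⟨hy, by omega, by omega⟩ (hx y)
  · exact ⟨y, hy, hzy, hyz⟩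

theorem exists_of_biUnion {ι : Type*} {T : ι → Set ℕ} {I : Finset ι}
    (h : IsPiecewiseSyndetic (⋃ i ∈ I, T i)) : ∃ i ∈ I, IsPiecewiseSyndetic (T i) := by
  classical
  induction I using Finset.induction_on with
  | empty =>
    obtain ⟨y, hy, -⟩ := h.exists_ge 0
    simp at hy
  | insert i I _ ih =>
    rw [Finset.set_biUnion_insert] at h
    rcases h.of_union with h | h
    · exact ⟨i, Finset.mem_insert_self _ _, h⟩
    · obtain ⟨j, hj, hT⟩ := ih h
      exact ⟨j, Finset.mem_insert_of_mem hj, hT⟩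

/-- A piecewise syndetic set contains every homothetic pattern `{u} ∪ {u + m * y | m ∈ M}` with a
common `y` for a piecewise syndetic set of `u`. -/
theorem exists_homothetic {S : Set ℕ} (hS : IsPiecewiseSyndetic S) (M : Finset ℕ) :
    ∃ y, 0 < y ∧ IsPiecewiseSyndetic {u | u ∈ S ∧ ∀ m ∈ M, u + m * y ∈ S} := by
  obtain ⟨n, hn⟩ := hS
  obtain ⟨L, hL⟩ := exists_bounded_mono_homothetic_copy (insert 0 M) (Fin (n + 1))
  have key : IsPiecewiseSyndetic
      (⋃ y ∈ Finset.Icc 1 L, {u | u ∈ S ∧ ∀ m ∈ M, u + m * y ∈ S}) := by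
    refine ⟨L + n, fun N => ?_⟩
    obtain ⟨a, ha⟩ := hn (N + L)
    refine ⟨a, fun x hax hxa => ?_⟩
    -- Colour `j` by an offset from `x + j` into `S`; a constant offset moves the whole copy into
    -- `S`.
    have hC : ∀ j, ∃ h : Fin (n + 1), j ≤ L → x + j + h ∈ S := by
      intro j
      by_cases hj : j ≤ L
      · obtain ⟨z, hz, h1, h2⟩ := ha (x + j) (by omega) (by omega)
        refine ⟨⟨z - (x + j), by omega⟩, fun _ => ?_⟩
        simpa [Nat.add_sub_cancel' h1] using hz
      · exact ⟨0, fun h => absurd h hj⟩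
    choose C hC using hC
    obtain ⟨y, b, i, hy, hyL, hbL, hs⟩ := hL C
    have hmem : ∀ s ∈ insert 0 M, x + b + i + s * y ∈ S := by
      intro s hsM
      obtain ⟨h1, h2⟩ := hs s hsM
      have := hC _ h1
      rw [h2] at this
      convert this using 1
      ring
    refine ⟨x + b + i, ?_, by omega, by omega⟩
    simp only [Set.mem_iUnion, Finset.mem_Icc, exists_prop]
    refine ⟨y, ⟨hy, hyL⟩, ?_, fun m hm => hmem m (Finset.mem_insert_of_mem hm)⟩
    simpa using hmem 0 (Finset.mem_insert_self _ _)
  obtain ⟨y, hy, h⟩ := key.exists_of_biUnion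
  exact ⟨y, (Finset.mem_Icc.mp hy).1, h⟩

theorem exists_const {κ : Type*} [Fintype κ] {S : Set ℕ} (hS : IsPiecewiseSyndetic S)
    (f : ℕ → κ) : ∃ i, IsPiecewiseSyndetic {u | u ∈ S ∧ f u = i} := by
  have : IsPiecewiseSyndetic (⋃ i ∈ (Finset.univ : Finset κ), {u | u ∈ S ∧ f u = i}) :=
    hS.mono fun u hu => by simpa using hu
  obtain ⟨i, -, h⟩ := this.exists_of_biUnion
  exact ⟨i, h⟩

end IsPiecewiseSyndetic

/-- There are divisibility chains `Q` of any finite length and a piecewise syndetic set `U` such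
that for `u ∈ U` and `p < q` in `Q` the numbers `u * p` and `u * p + q / p` have the same colour,
which depends on `p` only. -/
theorem exists_dvd_chain {κ : Type*} [Fintype κ] (c : ℕ → κ) (n : ℕ) :
    ∃ (Q : Finset ℕ) (t : ℕ → κ) (U : Set ℕ), Q.card = n ∧ IsPiecewiseSyndetic U ∧
      (∀ p ∈ Q, 0 < p) ∧ (∀ u ∈ U, 0 < u) ∧ (∀ p ∈ Q, ∀ u ∈ U, c (u * p) = t p) ∧
      ∀ p ∈ Q, ∀ q ∈ Q, p < q → p ∣ q ∧ ∀ u ∈ U, c (u * p + q / p) = t p := by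
  classical
  induction n with
  | zero =>
    exact ⟨∅, fun _ => c 0, {n | 0 < n}, rfl, .setOf_pos, by simp, fun _ h => h, by simp, by simp⟩
  | succ n ih =>
    obtain ⟨Q, t, U, hcard, hU, hQpos, hUpos, hprod, hsum⟩ := ih
    -- The factor 2 keeps `q` above every `p`, even for `Q = {1}`.
    set L := 2 * ∏ p ∈ Q, p with hLdef
    have hLpos : 0 < L := Nat.mul_pos two_pos (Finset.prod_pos hQpos)
    have hdvd : ∀ p ∈ Q, p ∣ L := fun p hp => (Finset.dvd_prod_of_mem _ hp).mul_left 2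
    -- With `q = L ^ 2 * y`, these shifts are exactly `q / p ^ 2`.
    obtain ⟨y, hy, hV⟩ := hU.exists_homothetic (Q.image fun p => (L / p) ^ 2)
    set q := L ^ 2 * y with hq
    obtain ⟨i, hW⟩ := hV.exists_const fun u => c (u * q)
    have hlt : ∀ p ∈ Q, p < q := by
      intro p hp
      have h1 : p ≤ ∏ p ∈ Q, p :=
        Nat.le_of_dvd (Finset.prod_pos hQpos) (Finset.dvd_prod_of_mem _ hp)
      have h2 := hQpos p hp
      nlinarith [Nat.mul_le_mul (Nat.mul_le_mul hLpos (le_refl L)) hy]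
    have hqQ : q ∉ Q := fun h => (hlt q h).false
    refine ⟨insert q Q, Function.update t q i, _, ?_, hW, ?_, ?_, ?_, ?_⟩
    · rw [Finset.card_insert_of_notMem hqQ, hcard]
    · intro p hp
      rcases Finset.mem_insert.mp hp with rfl | hp
      · positivity
      · exact hQpos p hp
    · exact fun u hu => hUpos u hu.1.1
    · intro p hp u hu
      rcases Finset.mem_insert.mp hp with rfl | hp
      · simpa using hu.2
      · rw [Function.update_of_ne (hlt p hp).ne]
        exact hprod p hp u hu.1.1
    · intro p hp s hs hps
      rcases Finset.mem_insert.mp hp with rfl | hp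
      · rcases Finset.mem_insert.mp hs with rfl | hs
        · exact absurd hps (lt_irrefl _)
        · exact absurd hps (hlt s hs).not_gt
      rw [Function.update_of_ne (hlt p hp).ne]
      rcases Finset.mem_insert.mp hs with rfl | hs
      · refine ⟨(dvd_pow (hdvd p hp) two_ne_zero).mul_right y, fun u hu => ?_⟩
        have hmem := hu.1.2 _ (Finset.mem_image_of_mem _ hp)
        rw [← hprod p hp _ hmem]
        congr 1
        obtain ⟨d, hd⟩ := hdvd p hp
        have hp0 := hQpos p hp
        rw [hq, hd, Nat.mul_div_cancel_left _ hp0,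
          show (p * d) ^ 2 * y = p * (p * d ^ 2 * y) by ring, Nat.mul_div_cancel_left _ hp0]
        ring
      · obtain ⟨h1, h2⟩ := hsum p hp s hs hps
        exact ⟨h1, fun u hu => h2 u hu.1.1⟩

theorem corollary2 (r : ℕ) (c : ℕ+ → Fin r) (k : ℕ) :
    ∃ (A : Set ℕ+) (B : Finset ℕ+), A.Infinite ∧ B.card = k ∧
      IsMonochromatic c ((A + (B : Set ℕ+)) ∪ (A * (B : Set ℕ+))) := by
  classical
  obtain ⟨Q, t, U, hcard, hU, hQpos, hUpos, hprod, hsum⟩ :=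
    exists_dvd_chain (fun n => c n.toPNat') (r * k + 1)
  obtain ⟨i, -, hi⟩ := Finset.exists_lt_card_fiber_of_mul_lt_card_of_maps_to
    (s := Q) (t := (Finset.univ : Finset (Fin r))) (f := t) (n := k)
    (fun _ _ => Finset.mem_univ _) (by simp [hcard])
  set F := {p ∈ Q | t p = i} with hF
  have hFne : F.Nonempty := Finset.card_pos.mp (by omega)
  set p := F.min' hFne with hp
  have hpF : p ∈ F := F.min'_mem hFne
  obtain ⟨hpQ, hpi⟩ := Finset.mem_filter.mp hpF
  have hp0 := hQpos p hpQ
  obtain ⟨G, hGF, hGcard⟩ := Finset.exists_subset_card_eq (s := F.erase p) (n := k)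
    (by rw [Finset.card_erase_of_mem hpF]; omega)
  have hG : ∀ q ∈ G, q ∈ Q ∧ t q = i ∧ p < q ∧ p ∣ q := by
    intro q hq
    obtain ⟨hne, hqF⟩ := Finset.mem_erase.mp (hGF hq)
    obtain ⟨hqQ, hqi⟩ := Finset.mem_filter.mp hqF
    have hlt : p < q := lt_of_le_of_ne (F.min'_le q hqF) hne.symm
    exact ⟨hqQ, hqi, hlt, (hsum p hpQ q hqQ hlt).1⟩
  have hdiv : ∀ q ∈ G, 0 < q / p := fun q hq =>
    Nat.div_pos (hG q hq).2.2.1.le hp0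
  refine ⟨(fun u : ℕ => (u * p).toPNat') '' U, G.image fun q => (q / p).toPNat', ?_, ?_, i, ?_⟩
  · refine hU.infinite.image fun u hu v hv huv => ?_
    have h := congrArg PNat.val huv
    simp only [Nat.toPNat'_coe, Nat.mul_pos (hUpos u hu) hp0, Nat.mul_pos (hUpos v hv) hp0,
      if_true] at h
    exact Nat.eq_of_mul_eq_mul_right hp0 h
  · rw [Finset.card_image_of_injOn, hGcard]
    intro q hq s hs hqs
    have h := congrArg PNat.val hqs
    simp only [Nat.toPNat'_coe, hdiv q hq, hdiv s hs, if_true] at h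
    rw [← Nat.div_mul_cancel (hG q hq).2.2.2, h, Nat.div_mul_cancel (hG s hs).2.2.2]
  · rintro n (hn | hn)
    · obtain ⟨_, ⟨u, hu, rfl⟩, b, hb, rfl⟩ := hn
      obtain ⟨q, hq, rfl⟩ := Finset.mem_image.mp (Finset.mem_coe.mp hb)
      have hup := Nat.mul_pos (hUpos u hu) hp0
      rw [← hpi, ← (hsum p hpQ q (hG q hq).1 (hG q hq).2.2.1).2 u hu]
      refine congrArg c (PNat.eq ?_)
      simp [Nat.toPNat'_coe, hup, hdiv q hq]
    · obtain ⟨_, ⟨u, hu, rfl⟩, b, hb, rfl⟩ := hn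
      obtain ⟨q, hq, rfl⟩ := Finset.mem_image.mp (Finset.mem_coe.mp hb)
      have hup := Nat.mul_pos (hUpos u hu) hp0
      have huq := Nat.mul_pos (hUpos u hu) (hQpos q (hG q hq).1)
      rw [← (hG q hq).2.1, ← hprod q (hG q hq).1 u hu]
      refine congrArg c (PNat.eq ?_)
      simp only [PNat.mul_coe, Nat.toPNat'_coe, hup, hdiv q hq, huq, if_true]
      rw [mul_assoc, Nat.mul_div_cancel' (hG q hq).2.2.2]
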